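/- Let $n\ge 0$ be an integer and let $\lambda_0,\lambda_1,\lambda_2\in\mathbb C$ be such that all the zeros of $$U(z)=\lambda_0+n\lambda_1 z+\frac{n(n-1)}{2}\lambda_2 z^2$$ lie in the half plane $|z|\le |z-n/2|$. For a complex polynomial $P$ of degree at most $n$ put $$B[P](z)=\lambda_0P(z)+\lambda_1\Big(\frac{nz}{2}\Big)\frac{P'(z)}{1!}+\lambda_2\Big(\frac{nz}{2}\Big)^2\frac{P''(z)}{2!}.$$ Let $0<k\le 1$ and $R>r\ge k$ be real numbers, and let $P$ be a complex polynomial of degree at most $n$ that does not vanish in $|z|<k$. Write $\sigma(z)=Rz$ and $\rho(z)=rz$. Then for all $\beta\in\mathbb C$ with $|\beta|\le 1$ and all $z\in\mathbb C$ with $|z|=1$, $$\begin{aligned} \left|B[P\circ\sigma](z)+\beta\Big(\frac{R+k}{k+r}\Big)^{n}B[P\circ\rho](z)\right| \le\frac12\Bigg[&\left\{\frac{|B[z^n](z)|}{k^n}\left|R^n+r^n\beta\Big(\frac{R+k}{k+r}\Big)^{n}\right|+\left|1+\beta\Big(\frac{R+k}{k+r}\Big)^{n}\right||\lambda_0|\right\}\max_{|w|=k}|P(w)|\\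 &-\left\{\frac{|B[z^n](z)|}{k^n}\left|R^n+r^n\beta\Big(\frac{R+k}{k+r}\Big)^{n}\right|-\left|1+\beta\Big(\frac{R+k}{k+r}\Big)^{n}\right||\lambda_0|\right\}\min_{|w|=k}|P(w)|\Bigg], \end{aligned}$$ where $B[z^n](z)$ is the value at $z$ of $B$ applied to the polynomial $w\mapsto w^n$. -/

import Mathlib

open Polynomial

noncomputable section

/-- The polynomial `U(z) = a₀ + n a₁ z + (n (n - 1) / 2) a₂ z ^ 2` attached to the parameters
`a₀, a₁, a₂` (the paper's `λ₀, λ₁, λ₂`) of an operator of the class `𝓑ₙ`.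
The coefficient of `z ^ 2` is computed in `ℂ`. -/
def characteristicPoly (n : ℕ) (a₀ a₁ a₂ : ℂ) : ℂ[X] :=
  C a₀ + C ((n : ℂ) * a₁) * X + C ((n : ℂ) * ((n : ℂ) - 1) / 2 * a₂) * X ^ 2

/-- Parameters of an operator in the class `𝓑ₙ`: all the zeros of `U` lie in the half plane
`|z| ≤ |z - n / 2|`. -/
def IsBnParameters (n : ℕ) (a₀ a₁ a₂ : ℂ) : Prop :=
  ∀ z : ℂ, (characteristicPoly n a₀ a₁ a₂).IsRoot z → ‖z‖ ≤ ‖z - (n : ℂ) / 2‖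

/-- The operator
`B[P](z) = a₀ P(z) + a₁ (n z / 2) P'(z) / 1! + a₂ (n z / 2) ^ 2 P''(z) / 2!`. -/
def operatorB (n : ℕ) (a₀ a₁ a₂ : ℂ) (P : ℂ[X]) : ℂ[X] :=
  C a₀ * P
    + C a₁ * (C ((n : ℂ) / 2) * X) * (C (1 / (Nat.factorial 1 : ℂ)) * derivative P)
    + C a₂ * (C ((n : ℂ) / 2) * X) ^ 2 *
        (C (1 / (Nat.factorial 2 : ℂ)) * derivative (derivative P))

/-- The dilation `z ↦ t z` as a polynomial, for real `t`. -/
def dilation (t : ℝ) : ℂ[X] := C (t : ℂ) * X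

/-- The maximum of `|P(z)|` over the circle `|z| = k`. -/
def maxModulus (k : ℝ) (P : ℂ[X]) : ℝ :=
  sSup ((fun z : ℂ => ‖P.eval z‖) '' Metric.sphere (0 : ℂ) k)

/-- The minimum of `|P(z)|` over the circle `|z| = k`. -/
def minModulus (k : ℝ) (P : ℂ[X]) : ℝ :=
  sInf ((fun z : ℂ => ‖P.eval z‖) '' Metric.sphere (0 : ℂ) k)

/-- The supremum defining `maxModulus` is attained. -/
theorem maxModulus_isGreatest {k : ℝ} (hk : 0 ≤ k) (P : ℂ[X]) :
    IsGreatest ((fun z : ℂ => ‖P.eval z‖) '' Metric.sphere (0 : ℂ) k) (maxModulus k P) :=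
  ((isCompact_sphere (0 : ℂ) k).image P.continuous.norm).isGreatest_sSup
    ((NormedSpace.sphere_nonempty.mpr hk).image _)

/-- The infimum defining `minModulus` is attained. -/
theorem minModulus_isLeast {k : ℝ} (hk : 0 ≤ k) (P : ℂ[X]) :
    IsLeast ((fun z : ℂ => ‖P.eval z‖) '' Metric.sphere (0 : ℂ) k) (minModulus k P) :=
  ((isCompact_sphere (0 : ℂ) k).image P.continuous.norm).isLeast_sInf
    ((NormedSpace.sphere_nonempty.mpr hk).image _)

end

open Polynomial

noncomputable section

/-! Fix `z` outside the closed unit disc. The quantity to bound is a linear functional `L` of the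
polynomial, and only one property of `L` matters: it does not vanish on polynomials of exact degree
`n` with all zeros in the closed disc.

That property has two sources. Passing from `f` to `f(Rz) + c f(rz)` preserves the class
(`ZerosInDisc.dilation_add`). The operator then creates no zero outside the disc
(`ZerosInDisc.operatorB_eval_ne_zero`): factoring `U` into affine factors shows that, for `n ≥ 2`,
`n(n-1) B[h](z)` is an iterated polar derivative of `h` at `z`, with both poles outside the disc, so
Laguerre's theorem applies.

For such `L`, domination on the unit circle passes to conjugate reciprocals
(`norm_apply_conjReflect_le`). Let `q` be the conjugate reciprocal of `p`. Subtracting from `p`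
constants of modulus just above `M` or just below `m` bounds `‖L p‖ + ‖L q‖` and `‖L p‖ - ‖L q‖`;
adding the bounds gives `two_mul_norm_apply_le`. Letting `z` tend to the circle and rescaling by `k`
finishes the proof. -/

/-! ### Laguerre's theorem -/

/-- `f` has degree exactly `N` and all its zeros lie in the closed unit disc. -/
structure ZerosInDisc (N : ℕ) (f : ℂ[X]) : Prop where
  natDegree_eq : f.natDegree = N
  ne_zero : f ≠ 0
  eval_ne_zero : ∀ z : ℂ, 1 < ‖z‖ → f.eval z ≠ 0

theorem ZerosInDisc.induction {motive : ℕ → ℂ[X] → Prop}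
    (const : ∀ c : ℂ, c ≠ 0 → motive 0 (C c))
    (step : ∀ (N : ℕ) (g : ℂ[X]) (ζ : ℂ), ZerosInDisc N g → ‖ζ‖ ≤ 1 → motive N g →
      motive (N + 1) ((X - C ζ) * g))
    {N : ℕ} {f : ℂ[X]} (hf : ZerosInDisc N f) : motive N f := by
  induction N generalizing f with
  | zero =>
    have h := eq_C_of_natDegree_eq_zero hf.natDegree_eq
    have h0 := hf.ne_zero
    rw [h] at h0 ⊢
    exact const _ (fun h1 => h0 (by rw [h1, C_0]))
  | succ N ih =>
    have hd : f.degree ≠ 0 := by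
      rw [degree_eq_natDegree hf.ne_zero, hf.natDegree_eq]
      exact_mod_cast Nat.succ_ne_zero N
    obtain ⟨ζ, hζ⟩ := IsAlgClosed.exists_root f hd
    obtain ⟨g, rfl⟩ := dvd_iff_isRoot.mpr hζ
    have hg0 : g ≠ 0 := right_ne_zero_of_mul hf.ne_zero
    have hζ1 : ‖ζ‖ ≤ 1 := by
      by_contra! h
      exact hf.eval_ne_zero ζ h hζ
    have hg : ZerosInDisc N g := by
      refine ⟨?_, hg0, fun z hz h => hf.eval_ne_zero z hz (by simp [h])⟩
      have h := hf.natDegree_eq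
      rw [natDegree_mul (X_sub_C_ne_zero ζ) hg0, natDegree_X_sub_C] at h
      omega
    exact step N g ζ hg hζ1 (ih hg)

theorem normSq_one_sub_conj_mul_sub (z w : ℂ) :
    Complex.normSq (1 - starRingEnd ℂ z * w) - Complex.normSq (z - w)
      = (1 - Complex.normSq z) * (1 - Complex.normSq w) := by
  simp only [Complex.normSq_apply, Complex.sub_re, Complex.sub_im, Complex.mul_re, Complex.mul_im,
    Complex.conj_re, Complex.conj_im, Complex.one_re, Complex.one_im]
  ring

theorem norm_one_sub_conj_mul_le {z w : ℂ} (hz : 1 ≤ ‖z‖) (hw : ‖w‖ ≤ 1) :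
    ‖1 - starRingEnd ℂ z * w‖ ≤ ‖z - w‖ := by
  have h := normSq_one_sub_conj_mul_sub z w
  simp only [Complex.normSq_eq_norm_sq] at h
  refine le_of_sq_le_sq ?_ (norm_nonneg _)
  nlinarith [mul_nonneg (show 0 ≤ ‖z‖ ^ 2 - 1 by nlinarith)
    (show 0 ≤ 1 - ‖w‖ ^ 2 by nlinarith [norm_nonneg w])]

/-- Here `f'/f` is the sum of the `1/(z - ζ)` over the zeros. Each term lies in the disc with centre
`conj z / (|z|² - 1)` and radius `1/(|z|² - 1)`, the image of the closed unit disc, so their mean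
does too by convexity. Denominators are cleared. -/
theorem ZerosInDisc.norm_derivative_le {N : ℕ} {f : ℂ[X]} (hf : ZerosInDisc N f) {z : ℂ}
    (hz : 1 < ‖z‖) :
    ‖((‖z‖ : ℂ) ^ 2 - 1) * (derivative f).eval z - N * starRingEnd ℂ z * f.eval z‖
      ≤ N * ‖f.eval z‖ := by
  refine ZerosInDisc.induction (motive := fun N f =>
    ‖((‖z‖ : ℂ) ^ 2 - 1) * (derivative f).eval z - N * starRingEnd ℂ z * f.eval z‖
      ≤ N * ‖f.eval z‖) ?_ ?_ hf
  · intro c hc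
    simp
  · intro N g ζ hg hζ ih
    have key : ((‖z‖ : ℂ) ^ 2 - 1) * (derivative ((X - C ζ) * g)).eval z
        - ((N + 1 : ℕ) : ℂ) * starRingEnd ℂ z * ((X - C ζ) * g).eval z
        = (z - ζ) * (((‖z‖ : ℂ) ^ 2 - 1) * (derivative g).eval z
            - N * starRingEnd ℂ z * g.eval z)
          - g.eval z * (1 - starRingEnd ℂ z * ζ) := by
      rw [← Complex.conj_mul']
      simp only [derivative_mul, derivative_sub, derivative_X, derivative_C, eval_add, eval_mul,
        eval_sub, eval_X, eval_C, eval_one, eval_zero]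
      push_cast
      ring
    rw [key]
    refine (norm_sub_le _ _).trans ?_
    simp only [norm_mul, eval_mul, eval_sub, eval_X, eval_C]
    push_cast
    have h1 := mul_le_mul_of_nonneg_left ih (norm_nonneg (z - ζ))
    have h2 := mul_le_mul_of_nonneg_left (norm_one_sub_conj_mul_le hz.le hζ)
      (norm_nonneg (g.eval z))
    nlinarith

/-- By Vieta, the ratio of these coefficients is minus the sum of `N` zeros in the disc. This keeps
the top coefficient of a polar derivative nonzero, so that its degree drops by exactly one. -/
theorem ZerosInDisc.norm_coeff_le {N : ℕ} {f : ℂ[X]} (hf : ZerosInDisc N f) :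
    ∀ M, N = M + 1 → ‖f.coeff M‖ ≤ N * ‖f.coeff N‖ := by
  refine ZerosInDisc.induction (motive := fun N f =>
    ∀ M, N = M + 1 → ‖f.coeff M‖ ≤ N * ‖f.coeff N‖) ?_ ?_ hf
  · intro c hc M hM
    omega
  · intro N g ζ hg hζ ih M hM
    obtain rfl : N = M := by omega
    have hz : g.coeff (N + 1) = 0 :=
      coeff_eq_zero_of_natDegree_lt (by rw [hg.natDegree_eq]; omega)
    have hN : ((X - C ζ) * g).coeff (N + 1) = g.coeff N := by
      rw [sub_mul, coeff_sub, coeff_X_mul, coeff_C_mul, hz]; ring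
    rw [hN]
    push_cast
    have h2 := mul_le_mul_of_nonneg_right hζ (norm_nonneg (g.coeff N))
    rcases N with _ | K
    · simp only [sub_mul, coeff_sub, mul_coeff_zero, coeff_X_zero]
      simpa using h2
    · have h1 := ih K rfl
      rw [sub_mul, coeff_sub, coeff_X_mul, coeff_C_mul]
      refine (norm_sub_le _ _).trans ?_
      rw [norm_mul]
      linarith

/-- The polar derivative of `f` (regarded as a form of degree `N`) with pole `b / a`. -/
def polarDerivative (N : ℕ) (a b : ℂ) (f : ℂ[X]) : ℂ[X] :=
  C (N * a) * f + (C b - C a * X) * derivative f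

/-- Laguerre's theorem for the unit disc. -/
theorem ZerosInDisc.polarDerivative {N : ℕ} {f : ℂ[X]} (hf : ZerosInDisc (N + 1) f) {a b : ℂ}
    (hab : ‖a‖ < ‖b‖) : ZerosInDisc N (polarDerivative (N + 1) a b f) := by
  have hcoeff : ∀ j, (_root_.polarDerivative (N + 1) a b f).coeff j
      = (N + 1 - j) * a * f.coeff j + b * (j + 1) * f.coeff (j + 1) := by
    intro j
    rw [_root_.polarDerivative, coeff_add, coeff_C_mul, sub_mul, coeff_sub, coeff_C_mul,
      mul_assoc (C a), coeff_C_mul, coeff_derivative]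
    rcases j with _ | j
    · simp
    · rw [coeff_X_mul, coeff_derivative]; push_cast; ring
  have hlead : f.coeff (N + 1) ≠ 0 := by
    rw [← hf.natDegree_eq]
    exact leadingCoeff_ne_zero.mpr hf.ne_zero
  have hN : (_root_.polarDerivative (N + 1) a b f).coeff N ≠ 0 := by
    rw [hcoeff]
    intro h
    have h1 : b * (N + 1) * f.coeff (N + 1) = -(a * f.coeff N) := by linear_combination h
    have h2 := congrArg norm h1
    have h3 : ‖(N : ℂ) + 1‖ = N + 1 := by exact_mod_cast Complex.norm_natCast (N + 1)
    rw [norm_neg, norm_mul, norm_mul, norm_mul, h3] at h2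
    have h4 := hf.norm_coeff_le N rfl
    push_cast at h4
    have h5 := mul_le_mul_of_nonneg_left h4 (norm_nonneg a)
    have h6 : 0 < ((N : ℝ) + 1) * ‖f.coeff (N + 1)‖ := by
      have := norm_pos_iff.mpr hlead
      positivity
    nlinarith [mul_lt_mul_of_pos_right hab h6]
  have hle : (_root_.polarDerivative (N + 1) a b f).natDegree ≤ N := by
    rw [natDegree_le_iff_coeff_eq_zero]
    intro j hj
    rw [hcoeff, coeff_eq_zero_of_natDegree_lt (n := j + 1) (by rw [hf.natDegree_eq]; omega)]
    rcases (Nat.succ_le_of_lt hj).eq_or_lt with rfl | h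
    · push_cast; ring
    · rw [coeff_eq_zero_of_natDegree_lt (n := j) (by rw [hf.natDegree_eq]; omega)]; ring
  refine ⟨natDegree_eq_of_le_of_coeff_ne_zero hle hN, fun h => hN (by rw [h, coeff_zero]), ?_⟩
  intro z hz h
  have hfz := norm_pos_iff.mpr (hf.eval_ne_zero z hz)
  simp only [_root_.polarDerivative, eval_add, eval_mul, eval_sub, eval_C, eval_X] at h
  -- A zero at `z` allows `f'(z)` to be eliminated. The disc estimate then forces `‖a - conj z * b‖
  -- ≤ ‖b - a * z‖`, which `‖a‖ < ‖b‖` and `1 < ‖z‖` exclude.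
  have key : (b - a * z) * (((‖z‖ : ℂ) ^ 2 - 1) * (derivative f).eval z
      - ((N + 1 : ℕ) : ℂ) * starRingEnd ℂ z * f.eval z)
      = ((N + 1 : ℕ) : ℂ) * f.eval z * (a - starRingEnd ℂ z * b) := by
    rw [← Complex.conj_mul']
    linear_combination (starRingEnd ℂ z * z - 1) * h
  have h1 := congrArg norm key
  simp only [norm_mul, Complex.norm_natCast] at h1
  have h2 := mul_le_mul_of_nonneg_left (hf.norm_derivative_le hz) (norm_nonneg (b - a * z))
  have h3 : (0 : ℝ) < (N + 1 : ℕ) * ‖f.eval z‖ := by positivity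
  have h4 : ‖a - starRingEnd ℂ z * b‖ ≤ ‖b - a * z‖ := by
    refine le_of_mul_le_mul_left ?_ h3
    linarith
  have h5 : Complex.normSq (a - starRingEnd ℂ z * b) - Complex.normSq (b - a * z)
      = (Complex.normSq z - 1) * (Complex.normSq b - Complex.normSq a) := by
    simp only [Complex.normSq_apply, Complex.sub_re, Complex.sub_im, Complex.mul_re,
      Complex.mul_im, Complex.conj_re, Complex.conj_im]
    ring
  simp only [Complex.normSq_eq_norm_sq] at h5
  have h6 := mul_pos (show 0 < ‖z‖ ^ 2 - 1 by nlinarith)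
    (show 0 < ‖b‖ ^ 2 - ‖a‖ ^ 2 by nlinarith [norm_nonneg a])
  nlinarith [norm_nonneg (a - starRingEnd ℂ z * b)]

/-! ### Operators of the class and zeros outside the disc -/

/-- A complex polynomial of degree at most two is a product of two affine factors. -/
theorem exists_affine_factors (A B D : ℂ) :
    ∃ c₁ d₁ c₂ d₂ : ℂ, c₁ * c₂ = A ∧ c₁ * d₂ + c₂ * d₁ = B ∧ d₁ * d₂ = D := by
  by_cases hD : D = 0
  · exact ⟨A, B, 1, 0, by ring, by ring, by rw [hD]; ring⟩
  · obtain ⟨s, hs⟩ := IsAlgClosed.exists_pow_nat_eq (B ^ 2 - 4 * A * D) (n := 2) (by norm_num)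
    refine ⟨(B + s) / 2, D, (B - s) / (2 * D), 1, ?_, ?_, by ring⟩
    · field_simp
      linear_combination -hs
    · field_simp
      ring

theorem characteristicPoly_eval (n : ℕ) (a₀ a₁ a₂ u : ℂ) :
    (characteristicPoly n a₀ a₁ a₂).eval u
      = a₀ + n * a₁ * u + (n : ℂ) * ((n : ℂ) - 1) / 2 * a₂ * u ^ 2 := by
  simp [characteristicPoly]

theorem operatorB_eval (n : ℕ) (a₀ a₁ a₂ : ℂ) (P : ℂ[X]) (z : ℂ) :
    (operatorB n a₀ a₁ a₂ P).eval z = a₀ * P.eval z + a₁ * (n / 2 * z) * (derivative P).eval z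
      + a₂ * (n / 2 * z) ^ 2 * (1 / 2 * (derivative (derivative P)).eval z) := by
  simp [operatorB]

/-- An affine factor `c + d u` of the characteristic polynomial gives a pole outside the disc. -/
theorem norm_lt_norm_pole {n : ℕ} (hn : n ≠ 0) {c d z : ℂ} (hcd : ¬(c = 0 ∧ d = 0))
    (hroot : ∀ u : ℂ, c + d * u = 0 → ‖u‖ ≤ ‖u - (n : ℂ) / 2‖) (hz : 1 < ‖z‖) :
    ‖c‖ < ‖z * (c + n / 2 * d)‖ := by
  have hle : ‖c‖ ≤ ‖c + n / 2 * d‖ := by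
    by_cases hd : d = 0
    · simp [hd]
    · have h := hroot (-c / d) (by field_simp; ring)
      have h2 := mul_le_mul_of_nonneg_left h (norm_nonneg d)
      rw [← norm_mul, ← norm_mul] at h2
      rw [← norm_neg c, ← norm_neg (c + _)]
      have e1 : d * (-c / d) = -c := by field_simp
      have e2 : d * (-c / d - n / 2) = -(c + n / 2 * d) := by rw [mul_sub, e1]; ring
      rwa [e1, e2] at h2
  rw [norm_mul]
  by_cases hc : c = 0
  · have hd : d ≠ 0 := fun h => hcd ⟨hc, h⟩
    have hn' : (n : ℂ) ≠ 0 := by exact_mod_cast hn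
    rw [hc, norm_zero, zero_add]
    have : 0 < ‖(n : ℂ) / 2 * d‖ := norm_pos_iff.mpr (mul_ne_zero (div_ne_zero hn' two_ne_zero) hd)
    positivity
  · have := norm_pos_iff.mpr hc
    nlinarith

/-- Operators of the class `𝓑ₙ` do not create zeros outside the closed unit disc. -/
theorem ZerosInDisc.operatorB_eval_ne_zero {n : ℕ} (hn : n ≠ 0) {a₀ a₁ a₂ : ℂ}
    (hB : IsBnParameters n a₀ a₁ a₂) {h : ℂ[X]} (hh : ZerosInDisc n h) {z : ℂ} (hz : 1 < ‖z‖) :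
    (operatorB n a₀ a₁ a₂ h).eval z ≠ 0 := by
  have hn' : (n : ℂ) ≠ 0 := by exact_mod_cast hn
  have hU : ∀ u : ℂ, a₀ + n * a₁ * u + (n : ℂ) * ((n : ℂ) - 1) / 2 * a₂ * u ^ 2 = 0 →
      ‖u‖ ≤ ‖u - (n : ℂ) / 2‖ := by
    intro u hu
    exact hB u (by rw [IsRoot.def, characteristicPoly_eval, hu])
  have hnot : ¬ ‖(n : ℂ) / 2‖ ≤ ‖(n : ℂ) / 2 - (n : ℂ) / 2‖ := by
    rw [sub_self, norm_zero, not_le]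
    exact norm_pos_iff.mpr (div_ne_zero hn' two_ne_zero)
  obtain ⟨c₁, d₁, c₂, d₂, h0, h1, h2⟩ :=
    exists_affine_factors a₀ (n * a₁) ((n : ℂ) * ((n : ℂ) - 1) / 2 * a₂)
  have hfac : ∀ u : ℂ, a₀ + n * a₁ * u + (n : ℂ) * ((n : ℂ) - 1) / 2 * a₂ * u ^ 2
      = (c₁ + d₁ * u) * (c₂ + d₂ * u) := by
    intro u; rw [← h0, ← h1, ← h2]; ring
  have hp₁ : ‖c₁‖ < ‖z * (c₁ + n / 2 * d₁)‖ := by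
    refine norm_lt_norm_pole hn ?_ (fun u hu => hU u (by rw [hfac, hu, zero_mul])) hz
    -- A zero factor would make `U` vanish identically, and `n / 2` violates the half-plane
    -- condition.
    rintro ⟨rfl, rfl⟩
    exact hnot (hU _ (by rw [hfac]; ring))
  have hp₂ : ‖c₂‖ < ‖z * (c₂ + n / 2 * d₂)‖ := by
    refine norm_lt_norm_pole hn ?_ (fun u hu => hU u (by rw [hfac, hu, mul_zero])) hz
    rintro ⟨rfl, rfl⟩
    exact hnot (hU _ (by rw [hfac]; ring))
  obtain _ | _ | m := n
  · exact absurd rfl hn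
  · have hd : derivative (derivative h) = 0 := by
      have hd1 : (derivative h).natDegree = 0 := by
        have := natDegree_derivative_le h
        rw [hh.natDegree_eq] at this
        omega
      exact derivative_of_natDegree_zero hd1
    -- For `n = 1` the polynomial `U` is affine, and a single polar derivative already equals
    -- `B[h](z)`.
    have hp : ‖a₀‖ < ‖z * (a₀ + (1 : ℕ) / 2 * a₁)‖ := by
      refine norm_lt_norm_pole one_ne_zero ?_ (fun u hu => hU u ?_) hz
      · rintro ⟨rfl, rfl⟩
        exact hnot (hU _ (by simp))
      · push_cast; linear_combination hu
    have := (hh.polarDerivative hp).eval_ne_zero z hz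
    rw [operatorB_eval, hd]
    convert this using 1
    simp only [_root_.polarDerivative, eval_add, eval_mul, eval_sub, eval_C, eval_X, eval_zero]
    push_cast
    ring
  · have := ((hh.polarDerivative hp₁).polarDerivative hp₂).eval_ne_zero z hz
    rw [operatorB_eval]
    refine fun h3 => this ?_
    simp only [_root_.polarDerivative, eval_add, eval_mul, eval_sub, eval_C, eval_X,
      derivative_add, derivative_mul, derivative_sub, derivative_C, derivative_X, eval_zero,
      eval_one]
    push_cast at h0 h1 h2 h3 ⊢
    have hm : (m : ℂ) + 1 + 1 ≠ 0 := by exact_mod_cast hn'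
    -- The pole numerators `z (c + n d / 2)` make `b - c z` equal to `n d z / 2`, so the double
    -- polar derivative at `z` is `n (n - 1) B[h](z)`.
    linear_combination ((m : ℂ) + 1 + 1) * (m + 1) * h3
      + ((m : ℂ) + 1 + 1) * (m + 1) * h.eval z * h0
      + ((m : ℂ) + 1 + 1) * (m + 1) / 2 * z * (derivative h).eval z * h1
      + ((m : ℂ) + 1 + 1) ^ 2 / 4 * z ^ 2 * (derivative (derivative h)).eval z * h2

/-! ### Dilations -/

theorem norm_dilation_factor_lt {r R : ℝ} (hr : 1 ≤ r) (hrR : r < R) {z ζ : ℂ} (hz : 1 < ‖z‖)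
    (hζ : ‖ζ‖ ≤ 1) : (R + 1) / (1 + r) * ‖(r : ℂ) * z - ζ‖ < ‖(R : ℂ) * z - ζ‖ := by
  have hz0 : z ≠ 0 := norm_pos_iff.mp (by linarith)
  obtain ⟨w, rfl⟩ : ∃ w, ζ = z * w := ⟨ζ / z, by field_simp⟩
  have hw : ‖w‖ < 1 := by
    rw [norm_mul] at hζ
    by_contra! h
    nlinarith
  have hfac : ∀ t : ℝ, ‖(t : ℂ) * z - z * w‖ = ‖z‖ * ‖(t : ℂ) - w‖ := by
    intro t; rw [← norm_mul]; congr 1; ring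
  rw [hfac, hfac, div_mul_eq_mul_div, div_lt_iff₀ (by linarith)]
  suffices h : (R + 1) * ‖(r : ℂ) - w‖ < ‖(R : ℂ) - w‖ * (1 + r) by
    nlinarith
  have hsq : ∀ t : ℝ, ‖(t : ℂ) - w‖ ^ 2 = t ^ 2 - 2 * t * w.re + ‖w‖ ^ 2 := by
    intro t
    simp only [← Complex.normSq_eq_norm_sq, Complex.normSq_apply, Complex.sub_re, Complex.sub_im,
      Complex.ofReal_re, Complex.ofReal_im]
    ring
  refine lt_of_pow_lt_pow_left₀ 2 (by positivity) ?_
  rw [mul_pow, mul_pow, hsq, hsq]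
  have hx : -‖w‖ ≤ w.re := (abs_le.mp (Complex.abs_re_le_norm w)).1
  set t := ‖w‖
  have ht : 0 ≤ t := norm_nonneg w
  have hRr : 0 ≤ r * R - 1 := by nlinarith
  -- The difference of squares is `R - r` times an expression that is nondecreasing in `w.re`,
  -- because `r * R ≥ 1`; `h1` is its value at the extreme `w.re = -t`.
  have h1 : 0 < (1 - t) * (2 * R * r + (R + r) * (1 + t) + 2 * t) := by
    have : 0 < 1 - t := by linarith
    have : 0 < r := by linarith
    have : 0 < R := by linarith
    positivity
  have h2 : 0 < 2 * R * r + R + r + 2 * w.re * (r * R - 1) - t ^ 2 * (R + r + 2) := by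
    nlinarith [mul_nonneg hRr (show 0 ≤ w.re + t by linarith)]
  nlinarith [mul_pos (sub_pos.mpr hrR) h2]

theorem dilation_comp_eval (f : ℂ[X]) (t : ℝ) (z : ℂ) :
    (f.comp (dilation t)).eval z = f.eval (t * z) := by
  simp [dilation]

theorem ZerosInDisc.norm_eval_dilation_le {N : ℕ} {f : ℂ[X]} (hf : ZerosInDisc N f) {r R : ℝ}
    (hr : 1 ≤ r) (hrR : r < R) {z : ℂ} (hz : 1 < ‖z‖) :
    ((R + 1) / (1 + r)) ^ N * ‖f.eval (r * z)‖ ≤ ‖f.eval (R * z)‖ := by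
  refine ZerosInDisc.induction (motive := fun N f =>
    ((R + 1) / (1 + r)) ^ N * ‖f.eval (r * z)‖ ≤ ‖f.eval (R * z)‖) ?_ ?_ hf
  · intro c hc
    simp
  · intro N g ζ hg hζ ih
    have h := mul_le_mul (norm_dilation_factor_lt hr hrR hz hζ).le ih
      (mul_nonneg (pow_nonneg (div_nonneg (by linarith) (by linarith)) _) (norm_nonneg _))
      (norm_nonneg _)
    simp only [eval_mul, eval_sub, eval_X, eval_C, norm_mul]
    refine le_trans (le_of_eq ?_) h
    ring

theorem one_lt_norm_real_mul {t : ℝ} (ht : 1 ≤ t) {z : ℂ} (hz : 1 < ‖z‖) : 1 < ‖(t : ℂ) * z‖ := by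
  rw [norm_mul, Complex.norm_real, Real.norm_of_nonneg (by linarith)]
  nlinarith

theorem ZerosInDisc.norm_eval_dilation_lt {N : ℕ} (hN : N ≠ 0) {f : ℂ[X]} (hf : ZerosInDisc N f)
    {r R : ℝ} (hr : 1 ≤ r) (hrR : r < R) {z : ℂ} (hz : 1 < ‖z‖) :
    ((R + 1) / (1 + r)) ^ N * ‖f.eval (r * z)‖ < ‖f.eval (R * z)‖ := by
  refine ZerosInDisc.induction (motive := fun N f => N ≠ 0 →
    ((R + 1) / (1 + r)) ^ N * ‖f.eval (r * z)‖ < ‖f.eval (R * z)‖) ?_ ?_ hf hN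
  · intro c hc h0
    exact absurd rfl h0
  · intro N g ζ hg hζ ih h0
    have h1 := norm_dilation_factor_lt hr hrR hz hζ
    have h2 := hg.norm_eval_dilation_le hr hrR hz
    have h3 := norm_pos_iff.mpr (hg.eval_ne_zero _ (one_lt_norm_real_mul (hr.trans hrR.le) hz))
    have h := mul_le_mul_of_nonneg_left h2
      (mul_nonneg (div_nonneg (show (0:ℝ) ≤ R + 1 by linarith) (show (0:ℝ) ≤ 1 + r by linarith))
        (norm_nonneg ((r : ℂ) * z - ζ)))
    have h4 := mul_lt_mul_of_pos_right h1 h3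
    simp only [eval_mul, eval_sub, eval_X, eval_C, norm_mul]
    refine lt_of_eq_of_lt ?_ (h.trans_lt h4)
    ring

theorem coeff_comp_dilation (f : ℂ[X]) (t : ℝ) (j : ℕ) :
    (f.comp (dilation t)).coeff j = f.coeff j * (t : ℂ) ^ j := by
  rw [dilation, comp_C_mul_X_coeff]

theorem ZerosInDisc.dilation_add {n : ℕ} (hn : n ≠ 0) {f : ℂ[X]} (hf : ZerosInDisc n f)
    {r R : ℝ} (hr : 1 ≤ r) (hrR : r < R) {β : ℂ} (hβ : ‖β‖ ≤ 1) :
    ZerosInDisc n (f.comp (dilation R)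
      + C (β * (((R + 1) / (1 + r) : ℝ) : ℂ) ^ n) * f.comp (dilation r)) := by
  have hq : 0 ≤ (R + 1) / (1 + r) := div_nonneg (by linarith) (by linarith)
  have hc : ‖β * (((R + 1) / (1 + r) : ℝ) : ℂ) ^ n‖ ≤ ((R + 1) / (1 + r)) ^ n := by
    rw [norm_mul, norm_pow, Complex.norm_real, Real.norm_of_nonneg hq]
    exact mul_le_of_le_one_left (pow_nonneg hq n) hβ
  set c := β * (((R + 1) / (1 + r) : ℝ) : ℂ) ^ n
  have hcoeff : ∀ j, (f.comp (dilation R) + C c * f.comp (dilation r)).coeff j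
      = f.coeff j * ((R : ℂ) ^ j + c * (r : ℂ) ^ j) := by
    intro j
    rw [coeff_add, coeff_C_mul, coeff_comp_dilation, coeff_comp_dilation]
    ring
  have hlead : f.coeff n ≠ 0 := by
    rw [← hf.natDegree_eq]
    exact leadingCoeff_ne_zero.mpr hf.ne_zero
  have hN : (f.comp (dilation R) + C c * f.comp (dilation r)).coeff n ≠ 0 := by
    rw [hcoeff]
    refine mul_ne_zero hlead fun h => ?_
    have h1 := congrArg norm (eq_neg_of_add_eq_zero_left h)
    rw [norm_neg, norm_mul, norm_pow, norm_pow, Complex.norm_real, Complex.norm_real,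
      Real.norm_of_nonneg (by linarith), Real.norm_of_nonneg (by linarith)] at h1
    -- This makes `R ^ n` strictly dominate `‖c‖ * r ^ n`, so the leading terms cannot cancel.
    have h2 : (R + 1) / (1 + r) * r < R := by
      rw [div_mul_eq_mul_div, div_lt_iff₀ (by linarith)]
      linarith
    have h3 := pow_lt_pow_left₀ h2 (mul_nonneg hq (by linarith)) hn
    rw [mul_pow] at h3
    have h4 := mul_le_mul_of_nonneg_right hc (pow_nonneg (show 0 ≤ r by linarith) n)
    linarith
  have hle : (f.comp (dilation R) + C c * f.comp (dilation r)).natDegree ≤ n := by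
    rw [natDegree_le_iff_coeff_eq_zero]
    intro j hj
    rw [hcoeff, coeff_eq_zero_of_natDegree_lt (by rw [hf.natDegree_eq]; exact hj), zero_mul]
  refine ⟨natDegree_eq_of_le_of_coeff_ne_zero hle hN, fun h => hN (by rw [h, coeff_zero]), ?_⟩
  intro z hz h
  rw [eval_add, eval_mul, eval_C, dilation_comp_eval, dilation_comp_eval] at h
  have h1 := congrArg norm (eq_neg_of_add_eq_zero_left h)
  rw [norm_neg, norm_mul] at h1
  have h2 := mul_le_mul_of_nonneg_right hc (norm_nonneg (f.eval ((r : ℂ) * z)))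
  have h3 := hf.norm_eval_dilation_lt hn hr hrR hz
  linarith

/-! ### Maximum modulus comparison -/

/-- Maximum modulus comparison on the unit disc, allowing common zeros on the circle. -/
theorem norm_eval_le_of_norm_eval_le_on_circle (f g : ℂ[X])
    (hf : ∀ z : ℂ, ‖z‖ < 1 → f.eval z ≠ 0)
    (hfg : ∀ z : ℂ, ‖z‖ = 1 → ‖g.eval z‖ ≤ ‖f.eval z‖) :
    ∀ z : ℂ, ‖z‖ ≤ 1 → ‖g.eval z‖ ≤ ‖f.eval z‖ := by
  have hf0 : f ≠ 0 := fun h => hf 0 (by simp) (by rw [h, eval_zero])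
  induction hd : f.natDegree generalizing f g with
  | zero =>
    intro z hz
    have hconst : ∀ w, f.eval w = f.eval 0 := by
      intro w
      rw [eq_C_of_natDegree_eq_zero hd, eval_C, eval_C]
    rw [hconst z]
    refine Complex.norm_le_of_forall_mem_frontier_norm_le (U := Metric.ball (0 : ℂ) 1)
      Metric.isBounded_ball g.differentiable.diffContOnCl ?_ ?_
    · intro w hw
      rw [frontier_ball _ one_ne_zero, mem_sphere_zero_iff_norm] at hw
      rw [← hconst w]
      exact hfg w hw
    · rwa [closure_ball _ one_ne_zero, mem_closedBall_zero_iff]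
  | succ d ih =>
    by_cases hroot : ∃ ζ : ℂ, ‖ζ‖ = 1 ∧ f.eval ζ = 0
    · obtain ⟨ζ, hζ, hfζ⟩ := hroot
      have hgζ : g.eval ζ = 0 := by
        have := hfg ζ hζ
        rw [hfζ, norm_zero] at this
        exact norm_le_zero_iff.mp this
      obtain ⟨f, rfl⟩ := dvd_iff_isRoot.mpr hfζ
      obtain ⟨g, rfl⟩ := dvd_iff_isRoot.mpr hgζ
      have hf1 : f ≠ 0 := right_ne_zero_of_mul hf0
      have hdeg : f.natDegree = d := by
        rw [natDegree_mul (X_sub_C_ne_zero ζ) hf1, natDegree_X_sub_C] at hd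
        omega
      have hcirc : ∀ z : ℂ, ‖z‖ = 1 → z ≠ ζ → ‖g.eval z‖ ≤ ‖f.eval z‖ := by
        intro z hz hne
        have h := hfg z hz
        simp only [eval_mul, norm_mul, eval_sub, eval_X, eval_C] at h
        exact le_of_mul_le_mul_left h (norm_pos_iff.mpr (sub_ne_zero.mpr hne))
      have hcirc' : ∀ z : ℂ, ‖z‖ = 1 → ‖g.eval z‖ ≤ ‖f.eval z‖ := by
        intro z hz
        by_cases hne : z = ζ
        · subst hne
          -- After cancelling the common zero, the inequality at that point is recovered by
          -- continuity along an arc of the circle.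
          let e : ℝ → ℂ := fun t => z * Complex.exp (t * Complex.I)
          have he : Continuous e := by fun_prop
          have he0 : e 0 = z := by simp [e]
          have hclosed : IsClosed {t : ℝ | ‖g.eval (e t)‖ ≤ ‖f.eval (e t)‖} :=
            isClosed_le (g.continuous.comp he).norm (f.continuous.comp he).norm
          have hev : ∀ᶠ t : ℝ in nhdsWithin 0 (Set.Ioi 0), ‖g.eval (e t)‖ ≤ ‖f.eval (e t)‖ := by
            filter_upwards [Ioo_mem_nhdsGT (show (0 : ℝ) < 1 by norm_num)] with t ht
            refine hcirc _ ?_ ?_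
            · simp [e, hz, Complex.norm_exp_ofReal_mul_I]
            · intro h
              have hz0 : z ≠ 0 := norm_pos_iff.mp (by rw [hz]; norm_num)
              have h1 : Complex.exp (t * Complex.I) = 1 := mul_left_cancel₀ hz0 (by rw [mul_one]; exact h)
              have h2 := congrArg Complex.im h1
              rw [Complex.exp_ofReal_mul_I_im, Complex.one_im] at h2
              exact (Real.sin_pos_of_pos_of_lt_pi ht.1
                (ht.2.trans (by linarith [Real.pi_gt_three]))).ne' h2
          have := hclosed.mem_of_frequently_of_tendsto hev.frequently
            (tendsto_nhdsWithin_of_tendsto_nhds (f := id) Filter.tendsto_id)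
          simpa only [Set.mem_ofPred_eq, he0] using this
        · exact hcirc z hz hne
      intro z hz
      simp only [eval_mul, norm_mul]
      refine mul_le_mul_of_nonneg_left ?_ (norm_nonneg _)
      exact ih f g (fun w hw h => hf w hw (by rw [eval_mul, h, mul_zero])) hcirc' hf1 hdeg z hz
    · have hne : ∀ z : ℂ, ‖z‖ ≤ 1 → f.eval z ≠ 0 := by
        intro z hz h
        rcases hz.lt_or_eq with h1 | h1
        · exact hf z h1 h
        · exact hroot ⟨z, h1, h⟩
      intro z hz
      have hdiff : DiffContOnCl ℂ (fun z => g.eval z / f.eval z) (Metric.ball (0 : ℂ) 1) := by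
        refine DifferentiableOn.diffContOnCl fun w hw => ?_
        rw [closure_ball _ one_ne_zero, mem_closedBall_zero_iff] at hw
        exact (g.differentiable.differentiableAt.div f.differentiable.differentiableAt
          (hne w hw)).differentiableWithinAt
      have := Complex.norm_le_of_forall_mem_frontier_norm_le (U := Metric.ball (0 : ℂ) 1) (C := 1)
        Metric.isBounded_ball hdiff ?_ (z := z) ?_
      · rwa [norm_div, div_le_one (norm_pos_iff.mpr (hne z hz))] at this
      · intro w hw
        rw [frontier_ball _ one_ne_zero, mem_sphere_zero_iff_norm] at hw
        rw [norm_div, div_le_one (norm_pos_iff.mpr (hne w hw.le))]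
        exact hfg w hw
      · rwa [closure_ball _ one_ne_zero, mem_closedBall_zero_iff]

/-! ### Conjugate reciprocals and linear functionals -/

/-- The conjugate reciprocal `z ^ n * conj (f (1 / conj z))` of `f`. -/
def conjReflect (n : ℕ) (f : ℂ[X]) : ℂ[X] := (f.map (starRingEnd ℂ)).reflect n

theorem conjReflect_add (n : ℕ) (f g : ℂ[X]) :
    conjReflect n (f + g) = conjReflect n f + conjReflect n g := by
  simp [conjReflect, Polynomial.map_add, reflect_add]

theorem conjReflect_sub (n : ℕ) (f g : ℂ[X]) :
    conjReflect n (f - g) = conjReflect n f - conjReflect n g := by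
  simp [conjReflect, Polynomial.map_sub, reflect_sub]

theorem conjReflect_C_mul (n : ℕ) (c : ℂ) (f : ℂ[X]) :
    conjReflect n (C c * f) = C (starRingEnd ℂ c) * conjReflect n f := by
  simp [conjReflect, reflect_C_mul]

theorem conjReflect_C (n : ℕ) (c : ℂ) : conjReflect n (C c) = C (starRingEnd ℂ c) * X ^ n := by
  simp [conjReflect, reflect_C]

theorem conjReflect_conjReflect (n : ℕ) (f : ℂ[X]) : conjReflect n (conjReflect n f) = f := by
  ext j
  simp [conjReflect, coeff_reflect]

theorem natDegree_conjReflect_le {n : ℕ} {f : ℂ[X]} (hf : f.natDegree ≤ n) :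
    (conjReflect n f).natDegree ≤ n := by
  rw [natDegree_le_iff_coeff_eq_zero]
  intro j hj
  rw [conjReflect, coeff_reflect, revAt_eq_self_of_lt hj, coeff_map,
    coeff_eq_zero_of_natDegree_lt (hf.trans_lt hj), map_zero]

theorem conjReflect_eval {n : ℕ} {f : ℂ[X]} (hf : f.natDegree ≤ n) {z : ℂ} (hz : z ≠ 0) :
    (conjReflect n f).eval z = z ^ n * starRingEnd ℂ (f.eval (starRingEnd ℂ z)⁻¹) := by
  let _ : Invertible z⁻¹ := invertibleOfNonzero (inv_ne_zero hz)
  have h := eval₂_reflect_mul_pow (RingHom.id ℂ) z⁻¹ n (f.map (starRingEnd ℂ))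
    ((natDegree_map_le).trans hf)
  rw [invOf_eq_inv, inv_inv, eval₂_id, eval₂_id, inv_pow, ← div_eq_mul_inv,
    div_eq_iff (pow_ne_zero n hz)] at h
  rw [conjReflect, h, mul_comm, ← eval_map_apply, map_inv₀, Complex.conj_conj]

theorem norm_conjReflect_eval {n : ℕ} {f : ℂ[X]} (hf : f.natDegree ≤ n) {z : ℂ} (hz : ‖z‖ = 1) :
    ‖(conjReflect n f).eval z‖ = ‖f.eval z‖ := by
  have hz0 : z ≠ 0 := norm_pos_iff.mp (by rw [hz]; norm_num)
  have h : (starRingEnd ℂ z)⁻¹ = z := by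
    rw [Complex.inv_def, Complex.normSq_eq_norm_sq, RCLike.norm_conj, hz]
    simp
  rw [conjReflect_eval hf hz0, h, norm_mul, norm_pow, hz, one_pow, one_mul, RCLike.norm_conj]

theorem zerosInDisc_conjReflect {n : ℕ} {f : ℂ[X]} (hd : f.natDegree ≤ n)
    (hf : ∀ z : ℂ, ‖z‖ < 1 → f.eval z ≠ 0) : ZerosInDisc n (conjReflect n f) := by
  have hn : (conjReflect n f).coeff n ≠ 0 := by
    have h0 := hf 0 (by simp)
    rw [← coeff_zero_eq_eval_zero] at h0
    simpa [conjReflect, coeff_reflect] using h0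
  refine ⟨natDegree_eq_of_le_of_coeff_ne_zero (natDegree_conjReflect_le hd) hn,
    fun h => hn (by rw [h, coeff_zero]), ?_⟩
  intro z hz
  have hz0 : z ≠ 0 := norm_pos_iff.mp (by linarith)
  rw [conjReflect_eval hd hz0]
  refine mul_ne_zero (pow_ne_zero _ hz0) ((_root_.map_ne_zero _).mpr (hf _ ?_))
  rw [norm_inv, RCLike.norm_conj]
  exact inv_lt_one_of_one_lt₀ hz

/-- If this failed, some `α` with `‖α‖ < 1` would make `L` vanish at the reflection of `f + conj α *
g`. That sum has no zero in the open disc by the maximum modulus comparison, so its reflection lies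
in the class where `L` is nonzero. -/
theorem norm_apply_conjReflect_le {n : ℕ} (L : ℂ[X] →ₗ[ℂ] ℂ)
    (hL : ∀ f, ZerosInDisc n f → L f ≠ 0) {f g : ℂ[X]} (hfd : f.natDegree ≤ n)
    (hgd : g.natDegree ≤ n) (hf : ∀ z : ℂ, ‖z‖ < 1 → f.eval z ≠ 0)
    (hfg : ∀ z : ℂ, ‖z‖ = 1 → ‖g.eval z‖ ≤ ‖f.eval z‖) :
    ‖L (conjReflect n g)‖ ≤ ‖L (conjReflect n f)‖ := by
  by_contra! hlt
  have hg0 : L (conjReflect n g) ≠ 0 := norm_pos_iff.mp ((norm_nonneg _).trans_lt hlt)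
  set α : ℂ := -L (conjReflect n f) / L (conjReflect n g) with hα
  have hα1 : ‖α‖ < 1 := by
    rw [hα, norm_div, norm_neg]
    exact (div_lt_one (norm_pos_iff.mpr hg0)).mpr hlt
  have hz : ZerosInDisc n (conjReflect n (f + C (starRingEnd ℂ α) * g)) := by
    refine zerosInDisc_conjReflect ?_ ?_
    · exact natDegree_add_le_of_degree_le hfd ((natDegree_C_mul_le _ _).trans hgd)
    · intro z hz h
      rw [eval_add, eval_mul, eval_C] at h
      have h1 := congrArg norm (eq_neg_of_add_eq_zero_left h)
      rw [norm_neg, norm_mul, RCLike.norm_conj] at h1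
      have h2 := norm_eval_le_of_norm_eval_le_on_circle f g hf hfg z hz.le
      have h3 := norm_pos_iff.mpr (hf z hz)
      nlinarith [mul_le_mul_of_nonneg_left h2 (norm_nonneg α), mul_pos h3 (sub_pos.mpr hα1)]
  refine hL _ hz ?_
  rw [conjReflect_add, conjReflect_C_mul, Complex.conj_conj, map_add, ← smul_eq_C_mul, map_smul,
    smul_eq_mul, hα]
  field_simp
  simp

/-- The number `e` turns `w` onto the ray of `v`, and one choice serves every `t`. -/
theorem exists_norm_eq_one_norm_sub (v w : ℂ) :
    ∃ e : ℂ, ‖e‖ = 1 ∧ ∀ t : ℝ, ‖v - e * t * w‖ = |‖v‖ - t * ‖w‖| := by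
  obtain ⟨a, ha, hva⟩ : ∃ a : ℂ, ‖a‖ = 1 ∧ v = a * ‖v‖ :=
    ⟨Complex.exp (v.arg * Complex.I), Complex.norm_exp_ofReal_mul_I _, by
      rw [mul_comm, Complex.norm_mul_exp_arg_mul_I]⟩
  obtain ⟨b, hb, hwb⟩ : ∃ b : ℂ, ‖b‖ = 1 ∧ w = b * ‖w‖ :=
    ⟨Complex.exp (w.arg * Complex.I), Complex.norm_exp_ofReal_mul_I _, by
      rw [mul_comm, Complex.norm_mul_exp_arg_mul_I]⟩
  have hb0 : b ≠ 0 := norm_pos_iff.mp (by rw [hb]; norm_num)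
  refine ⟨a / b, by rw [norm_div, ha, hb, div_one], fun t => ?_⟩
  have : v - a / b * t * w = a * ((‖v‖ - t * ‖w‖ : ℝ) : ℂ) := by
    conv_lhs => rw [hva, hwb]
    push_cast
    field_simp
  rw [this, norm_mul, ha, one_mul, Complex.norm_real, Real.norm_eq_abs]

/-- The growth estimate for linear functionals that do not vanish on polynomials of degree `n`
with all zeros in the closed unit disc. -/
theorem two_mul_norm_apply_le {n : ℕ} (L : ℂ[X] →ₗ[ℂ] ℂ)
    (hL : ∀ f, ZerosInDisc n f → L f ≠ 0) {p : ℂ[X]} (hd : p.natDegree ≤ n)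
    (hp : ∀ z : ℂ, ‖z‖ < 1 → p.eval z ≠ 0) {m M : ℝ} (hm0 : 0 ≤ m)
    (hm : ∀ z : ℂ, ‖z‖ = 1 → m ≤ ‖p.eval z‖) (hM : ∀ z : ℂ, ‖z‖ = 1 → ‖p.eval z‖ ≤ M) :
    2 * ‖L p‖ ≤ (‖L (X ^ n)‖ + ‖L 1‖) * M - (‖L (X ^ n)‖ - ‖L 1‖) * m := by
  set q := conjReflect n p with hq
  have hqp : conjReflect n q = p := conjReflect_conjReflect n p
  have hqd : q.natDegree ≤ n := natDegree_conjReflect_le hd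
  have hCd : ∀ c : ℂ, (C c : ℂ[X]).natDegree ≤ n := fun c => by simp
  have hLC : ∀ c : ℂ, L (C c) = c * L 1 := fun c => by
    rw [← mul_one (C c), ← smul_eq_C_mul, map_smul, smul_eq_mul]
  have hLX : ∀ c : ℂ, L (conjReflect n (C c)) = starRingEnd ℂ c * L (X ^ n) := fun c => by
    rw [conjReflect_C, ← smul_eq_C_mul, map_smul, smul_eq_mul]
  have shift : ∀ κ : ℂ, (∀ z : ℂ, ‖z‖ < 1 → p.eval z ≠ κ) →
      ‖L p - κ * L 1‖ ≤ ‖L q - starRingEnd ℂ κ * L (X ^ n)‖ := by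
    intro κ hκ
    have hsd : (p - C κ).natDegree ≤ n :=
      (natDegree_sub_le _ _).trans (max_le hd (hCd κ))
    have h := norm_apply_conjReflect_le L hL (f := p - C κ) (g := conjReflect n (p - C κ)) hsd
      (natDegree_conjReflect_le hsd)
      (fun z hz => by rw [eval_sub, eval_C]; exact sub_ne_zero.mpr (hκ z hz))
      (fun z hz => (norm_conjReflect_eval hsd hz).le)
    rwa [conjReflect_conjReflect, conjReflect_sub, map_sub, map_sub, hLC, hLX] at h
  obtain ⟨e, he, hvw⟩ := exists_norm_eq_one_norm_sub (L q) (L (X ^ n))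
  have conj_e : ∀ t : ℝ, starRingEnd ℂ (starRingEnd ℂ e * t) = e * t := fun t => by simp
  have norm_e : ∀ t : ℝ, 0 ≤ t → ‖starRingEnd ℂ e * t‖ = t := fun t ht => by
    rw [norm_mul, RCLike.norm_conj, he, one_mul, Complex.norm_real, Real.norm_of_nonneg ht]
  have upper : ∀ K : ℝ, M < K → ‖L p‖ + ‖L q‖ ≤ K * (‖L (X ^ n)‖ + ‖L 1‖) := by
    intro K hK
    have hK0 : 0 < K :=
      ((norm_nonneg _).trans (hM 1 (by simp))).trans_lt hK
    have hnK : ∀ z, ‖(C (K : ℂ)).eval z‖ = K := fun z => by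
      rw [eval_C, Complex.norm_real, Real.norm_of_nonneg hK0.le]
    have hKne : ∀ z : ℂ, ‖z‖ < 1 → (C (K : ℂ)).eval z ≠ 0 := fun z _ =>
      norm_pos_iff.mp (by rw [hnK]; exact hK0)
    have hpM : ∀ z : ℂ, ‖z‖ < 1 → ‖p.eval z‖ < K := by
      -- The comparison is weak; an intermediate constant makes it strict.
      obtain ⟨K', hK1, hK2⟩ := exists_between hK
      have hK0' : 0 < K' := ((norm_nonneg _).trans (hM 1 (by simp))).trans_lt hK1
      have hnK' : ∀ z, ‖(C (K' : ℂ)).eval z‖ = K' := fun z => by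
        rw [eval_C, Complex.norm_real, Real.norm_of_nonneg hK0'.le]
      intro z hz
      refine lt_of_le_of_lt ?_ hK2
      rw [← hnK' z]
      refine norm_eval_le_of_norm_eval_le_on_circle _ p (fun z _ =>
        norm_pos_iff.mp (by rw [hnK']; exact hK0')) ?_ z hz.le
      intro w hw
      rw [hnK']
      exact (hM w hw).trans hK1.le
    have hqK : ‖L q‖ ≤ K * ‖L (X ^ n)‖ := by
      have := norm_apply_conjReflect_le L hL (hCd K) hd hKne
        (fun z hz => by rw [hnK]; exact (hM z hz).trans hK.le)
      rwa [hLX, norm_mul, RCLike.norm_conj, Complex.norm_real, Real.norm_of_nonneg hK0.le] at this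
    have h := shift (starRingEnd ℂ e * K) fun z hz h => by
      have h1 := hpM z hz
      rw [h, norm_e K hK0.le] at h1
      exact lt_irrefl _ h1
    rw [conj_e, hvw, abs_of_nonpos (by linarith)] at h
    have h1 := norm_sub_norm_le (L p) (starRingEnd ℂ e * K * L 1)
    rw [norm_mul, norm_e K hK0.le] at h1
    linarith
  -- The alternative `t = 0` covers `m = 0`, where no `t` lies in `[0, m)`; there `p` itself has no
  -- zero in the open disc.
  have lower : ∀ t : ℝ, 0 ≤ t → (t < m ∨ t = 0) →
      ‖L p‖ - t * ‖L 1‖ ≤ ‖L q‖ - t * ‖L (X ^ n)‖ := by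
    intro t ht htm
    have htm' : t ≤ m := by
      rcases htm with h | h
      · exact h.le
      · rwa [h]
    have hnt : ∀ z, ‖(C (t : ℂ)).eval z‖ = t := fun z => by
      rw [eval_C, Complex.norm_real, Real.norm_of_nonneg ht]
    have hmq : t * ‖L (X ^ n)‖ ≤ ‖L q‖ := by
      have := norm_apply_conjReflect_le L hL hd (hCd t) hp
        (fun z hz => by rw [hnt]; exact htm'.trans (hm z hz))
      rwa [hLX, norm_mul, RCLike.norm_conj, Complex.norm_real, Real.norm_of_nonneg ht] at this
    have h := shift (starRingEnd ℂ e * t) fun z hz h => by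
      rcases htm with h1 | h1
      · have hnm : ∀ z, ‖(C (m : ℂ)).eval z‖ = m := fun z => by
          rw [eval_C, Complex.norm_real, Real.norm_of_nonneg hm0]
        have h2 := norm_eval_le_of_norm_eval_le_on_circle p (C (m : ℂ)) hp
          (fun w hw => by rw [hnm]; exact hm w hw) z hz.le
        rw [hnm, h, norm_e t ht] at h2
        linarith
      · exact hp z hz (by rw [h, h1]; simp)
    rw [conj_e, hvw, abs_of_nonneg (by linarith)] at h
    have h1 := norm_sub_norm_le (L p) (starRingEnd ℂ e * t * L 1)
    rw [norm_mul, norm_e t ht] at h1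
    linarith
  have hupper : ‖L p‖ + ‖L q‖ ≤ M * (‖L (X ^ n)‖ + ‖L 1‖) :=
    ge_of_tendsto (x := nhdsWithin M (Set.Ioi M)) (f := fun K => K * (‖L (X ^ n)‖ + ‖L 1‖))
      (((continuous_id.mul continuous_const).tendsto M).mono_left nhdsWithin_le_nhds)
      (by filter_upwards [self_mem_nhdsWithin] with K hK using upper K hK)
  have hlower : ‖L p‖ - m * ‖L 1‖ ≤ ‖L q‖ - m * ‖L (X ^ n)‖ := by
    rcases hm0.eq_or_lt with h0 | h0
    · rw [← h0]
      exact lower 0 le_rfl (Or.inr rfl)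
    · refine le_of_tendsto_of_tendsto (b := nhdsWithin m (Set.Iio m))
        (f := fun t => ‖L p‖ - t * ‖L 1‖) (g := fun t => ‖L q‖ - t * ‖L (X ^ n)‖)
        (((continuous_const.sub (continuous_id.mul continuous_const)).tendsto m).mono_left
          nhdsWithin_le_nhds)
        (((continuous_const.sub (continuous_id.mul continuous_const)).tendsto m).mono_left
          nhdsWithin_le_nhds) ?_
      filter_upwards [Ioo_mem_nhdsLT h0] with t ht using lower t ht.1.le (Or.inl ht.2)
  linarith

/-! ### The estimate on the circle -/

/-- The combination `B[P(R ·)](z) + c B[P(r ·)](z)`, as a polynomial in `z`. -/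
def dilatedOperator (n : ℕ) (a₀ a₁ a₂ : ℂ) (R r : ℝ) (c : ℂ) (P : ℂ[X]) : ℂ[X] :=
  operatorB n a₀ a₁ a₂ (P.comp (dilation R)) + C c * operatorB n a₀ a₁ a₂ (P.comp (dilation r))

theorem dilatedOperator_eval (n : ℕ) (a₀ a₁ a₂ : ℂ) (R r : ℝ) (c : ℂ) (P : ℂ[X]) (z : ℂ) :
    (dilatedOperator n a₀ a₁ a₂ R r c P).eval z
      = (operatorB n a₀ a₁ a₂ (P.comp (dilation R))).eval z
        + c * (operatorB n a₀ a₁ a₂ (P.comp (dilation r))).eval z := by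
  rw [dilatedOperator, eval_add, eval_mul, eval_C]

/-- Evaluation of `dilatedOperator` at a point, as a linear functional. -/
def dilatedOperatorAt (n : ℕ) (a₀ a₁ a₂ : ℂ) (R r : ℝ) (c z : ℂ) : ℂ[X] →ₗ[ℂ] ℂ where
  toFun P := (dilatedOperator n a₀ a₁ a₂ R r c P).eval z
  map_add' P Q := by
    simp only [dilatedOperator_eval, operatorB_eval, add_comp, derivative_add, eval_add]
    ring
  map_smul' s P := by
    simp only [dilatedOperator_eval, operatorB_eval, smul_comp, derivative_smul, eval_smul,
      smul_eq_mul, RingHom.id_apply]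
    ring

theorem dilatedOperatorAt_ne_zero {n : ℕ} (hn : n ≠ 0) {a₀ a₁ a₂ : ℂ}
    (hB : IsBnParameters n a₀ a₁ a₂) {r R : ℝ} (hr : 1 ≤ r) (hrR : r < R) {β : ℂ}
    (hβ : ‖β‖ ≤ 1) {z : ℂ} (hz : 1 < ‖z‖) {f : ℂ[X]} (hf : ZerosInDisc n f) :
    dilatedOperatorAt n a₀ a₁ a₂ R r (β * (((R + 1) / (1 + r) : ℝ) : ℂ) ^ n) z f ≠ 0 := by
  have h := (hf.dilation_add hn hr hrR hβ).operatorB_eval_ne_zero hn hB hz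
  convert h using 1
  change (dilatedOperator n a₀ a₁ a₂ R r _ f).eval z = _
  simp only [dilatedOperator_eval, operatorB_eval, derivative_add, derivative_C_mul, eval_add,
    eval_mul, eval_C]
  ring

theorem operatorB_C_mul (n : ℕ) (a₀ a₁ a₂ c : ℂ) (P : ℂ[X]) :
    operatorB n a₀ a₁ a₂ (C c * P) = C c * operatorB n a₀ a₁ a₂ P := by
  simp only [operatorB, derivative_C_mul]
  ring

theorem operatorB_C (n : ℕ) (a₀ a₁ a₂ c : ℂ) : operatorB n a₀ a₁ a₂ (C c) = C (a₀ * c) := by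
  simp [operatorB]

/-- The estimate for polynomials without zeros in the unit disc. -/
theorem two_mul_norm_dilatedOperator_le {n : ℕ} (hn : n ≠ 0) {a₀ a₁ a₂ : ℂ}
    (hB : IsBnParameters n a₀ a₁ a₂) {r R : ℝ} (hr : 1 ≤ r) (hrR : r < R) {β : ℂ}
    (hβ : ‖β‖ ≤ 1) {p : ℂ[X]} (hd : p.natDegree ≤ n)
    (hp : ∀ z : ℂ, ‖z‖ < 1 → p.eval z ≠ 0) {m M : ℝ} (hm0 : 0 ≤ m)
    (hm : ∀ z : ℂ, ‖z‖ = 1 → m ≤ ‖p.eval z‖) (hM : ∀ z : ℂ, ‖z‖ = 1 → ‖p.eval z‖ ≤ M)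
    {c : ℂ} (hc : c = β * (((R + 1) / (1 + r) : ℝ) : ℂ) ^ n) {z : ℂ} (hz : ‖z‖ = 1) :
    2 * ‖(dilatedOperator n a₀ a₁ a₂ R r c p).eval z‖
      ≤ (‖(operatorB n a₀ a₁ a₂ (X ^ n)).eval z‖ * ‖(R : ℂ) ^ n + (r : ℂ) ^ n * c‖
          + ‖1 + c‖ * ‖a₀‖) * M
        - (‖(operatorB n a₀ a₁ a₂ (X ^ n)).eval z‖ * ‖(R : ℂ) ^ n + (r : ℂ) ^ n * c‖
          - ‖1 + c‖ * ‖a₀‖) * m := by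
  have hX : ∀ w : ℂ, ‖(dilatedOperator n a₀ a₁ a₂ R r c (X ^ n)).eval w‖
      = ‖(operatorB n a₀ a₁ a₂ (X ^ n)).eval w‖ * ‖(R : ℂ) ^ n + (r : ℂ) ^ n * c‖ := by
    intro w
    rw [← norm_mul]
    simp only [dilatedOperator_eval, dilation, X_pow_comp, mul_pow, ← C_pow, operatorB_C_mul,
      eval_mul, eval_C]
    congr 1
    ring
  have h1 : ∀ w : ℂ, ‖(dilatedOperator n a₀ a₁ a₂ R r c 1).eval w‖ = ‖1 + c‖ * ‖a₀‖ := by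
    intro w
    rw [← norm_mul, ← C_1]
    simp only [dilatedOperator_eval, C_comp, operatorB_C, eval_C]
    congr 1
    ring
  rw [← hX, ← h1 z]
  have hclosed : IsClosed {w : ℂ | 2 * ‖(dilatedOperator n a₀ a₁ a₂ R r c p).eval w‖
      ≤ (‖(dilatedOperator n a₀ a₁ a₂ R r c (X ^ n)).eval w‖
          + ‖(dilatedOperator n a₀ a₁ a₂ R r c 1).eval w‖) * M
        - (‖(dilatedOperator n a₀ a₁ a₂ R r c (X ^ n)).eval w‖
          - ‖(dilatedOperator n a₀ a₁ a₂ R r c 1).eval w‖) * m} :=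
    isClosed_le (by fun_prop) (by fun_prop)
  have hlim : Filter.Tendsto (fun t : ℝ => (t : ℂ) * z) (nhdsWithin 1 (Set.Ioi 1)) (nhds z) := by
    have h : Continuous fun t : ℝ => (t : ℂ) * z := by fun_prop
    have h2 := (h.tendsto 1).mono_left (nhdsWithin_le_nhds (s := Set.Ioi 1))
    simpa using h2
  -- Nonvanishing is known only for `‖w‖ > 1`, so the point of the circle is approached radially
  -- from outside.
  refine hclosed.mem_of_tendsto hlim ?_
  filter_upwards [self_mem_nhdsWithin] with t ht
  have ht' : (1 : ℝ) < t := ht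
  have hw : 1 < ‖(t : ℂ) * z‖ := by
    rwa [norm_mul, hz, mul_one, Complex.norm_real, Real.norm_of_nonneg (by linarith)]
  refine two_mul_norm_apply_le (dilatedOperatorAt n a₀ a₁ a₂ R r c ((t : ℂ) * z))
    (fun f hf => ?_) hd hp hm0 hm hM
  rw [hc]
  exact dilatedOperatorAt_ne_zero hn hB hr hrR hβ hw hf

theorem comp_dilation_comp (P : ℂ[X]) (k t : ℝ) (hk : k ≠ 0) :
    P.comp (dilation t) = (P.comp (dilation k)).comp (dilation (t / k)) := by
  have hk' : (k : ℂ) ≠ 0 := by exact_mod_cast hk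
  rw [comp_assoc]
  congr 1
  simp only [dilation, mul_comp, C_comp, X_comp]
  rw [← mul_assoc, ← C_mul, Complex.ofReal_div, mul_div_cancel₀ _ hk']

end

theorem corollary2p8 (n : ℕ) (a₀ a₁ a₂ : ℂ) (hB : IsBnParameters n a₀ a₁ a₂)
    (P : ℂ[X]) (hdeg : P.natDegree ≤ n) (k r R : ℝ) (hk0 : 0 < k) (hk1 : k ≤ 1)
    (hP : ∀ w : ℂ, ‖w‖ < k → P.eval w ≠ 0) (hkr : k ≤ r) (hrR : r < R)
    (β : ℂ) (hβ : ‖β‖ ≤ 1) (z : ℂ) (hz : ‖z‖ = 1) :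
    ‖(operatorB n a₀ a₁ a₂ (P.comp (dilation R))).eval z
        + β * (((R + k) / (k + r) : ℝ) : ℂ) ^ n *
          (operatorB n a₀ a₁ a₂ (P.comp (dilation r))).eval z‖
      ≤ 1 / 2 *
        ((‖(operatorB n a₀ a₁ a₂ (X ^ n)).eval z‖ / k ^ n *
              ‖(R : ℂ) ^ n + (r : ℂ) ^ n * β * (((R + k) / (k + r) : ℝ) : ℂ) ^ n‖
            + ‖1 + β * (((R + k) / (k + r) : ℝ) : ℂ) ^ n‖ * ‖a₀‖) * maxModulus k P
          - (‖(operatorB n a₀ a₁ a₂ (X ^ n)).eval z‖ / k ^ n *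
              ‖(R : ℂ) ^ n + (r : ℂ) ^ n * β * (((R + k) / (k + r) : ℝ) : ℂ) ^ n‖
            - ‖1 + β * (((R + k) / (k + r) : ℝ) : ℂ) ^ n‖ * ‖a₀‖) * minModulus k P) := by
  have hmax := maxModulus_isGreatest hk0.le P
  have hmin := minModulus_isLeast hk0.le P
  rcases eq_or_ne n 0 with rfl | hn
  -- For `n = 0` the polynomial is constant and both sides agree.
  · obtain ⟨s, rfl⟩ : ∃ s, P = C s := ⟨_, eq_C_of_natDegree_le_zero hdeg⟩
    obtain ⟨w, -, hw⟩ := hmax.1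
    obtain ⟨v, -, hv⟩ := hmin.1
    simp only [eval_C] at hw hv
    rw [← hw, ← hv]
    simp only [C_comp, operatorB_C, eval_C, pow_zero, mul_one]
    rw [show a₀ * s + β * (a₀ * s) = (1 + β) * a₀ * s by ring, norm_mul, norm_mul]
    linarith
  · have hk : (k : ℂ) ≠ 0 := by exact_mod_cast hk0.ne'
    have hnorm : ∀ w : ℂ, ‖(k : ℂ) * w‖ = k * ‖w‖ := fun w => by
      rw [norm_mul, Complex.norm_real, Real.norm_of_nonneg hk0.le]
    have hmem : ∀ w : ℂ, ‖w‖ = 1 → (k : ℂ) * w ∈ Metric.sphere (0 : ℂ) k := fun w hw => by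
      rw [mem_sphere_zero_iff_norm, hnorm, hw, mul_one]
    have hm0 : 0 ≤ minModulus k P := by
      obtain ⟨v, -, hv⟩ := hmin.1
      rw [← hv]
      exact norm_nonneg _
    have hquot : (R + k) / (k + r) = (R / k + 1) / (1 + r / k) := by
      field_simp
    have hpow : ‖(R : ℂ) ^ n + (r : ℂ) ^ n * β * (((R + k) / (k + r) : ℝ) : ℂ) ^ n‖
        = k ^ n * ‖((R / k : ℝ) : ℂ) ^ n
          + ((r / k : ℝ) : ℂ) ^ n * (β * (((R + k) / (k + r) : ℝ) : ℂ) ^ n)‖ := by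
      have hkn : k ^ n = ‖(k : ℂ) ^ n‖ := by
        rw [norm_pow, Complex.norm_real, Real.norm_of_nonneg hk0.le]
      rw [hkn, ← norm_mul]
      congr 1
      rw [mul_add, ← mul_assoc, ← mul_pow, ← mul_pow, Complex.ofReal_div R k, Complex.ofReal_div r k,
        mul_div_cancel₀ _ hk, mul_div_cancel₀ _ hk, mul_assoc]
    -- Apply the unit disc case to `P(k z)` with radii `R / k` and `r / k`; the quotient `(R + k) /
    -- (k + r)` is unchanged.
    have h := two_mul_norm_dilatedOperator_le hn hB (r := r / k) (R := R / k)
      ((one_le_div hk0).mpr hkr) ((div_lt_div_iff_of_pos_right hk0).mpr hrR) hβ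
      (p := P.comp (dilation k)) ?_ ?_ hm0 (M := maxModulus k P) ?_ ?_
      (c := β * (((R + k) / (k + r) : ℝ) : ℂ) ^ n) (by rw [hquot]) hz
    · rw [dilatedOperator_eval, ← comp_dilation_comp P k R hk0.ne',
        ← comp_dilation_comp P k r hk0.ne'] at h
      rw [hpow, ← mul_assoc, div_mul_cancel₀ _ (pow_ne_zero n hk0.ne')]
      linarith
    · rw [natDegree_le_iff_coeff_eq_zero]
      intro j hj
      rw [coeff_comp_dilation, coeff_eq_zero_of_natDegree_lt (hdeg.trans_lt hj), zero_mul]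
    · intro w hw
      rw [dilation_comp_eval]
      refine hP _ ?_
      rw [hnorm]
      nlinarith
    · intro w hw
      rw [dilation_comp_eval]
      exact hmin.2 (Set.mem_image_of_mem _ (hmem w hw))
    · intro w hw
      rw [dilation_comp_eval]
      exact hmax.2 (Set.mem_image_of_mem _ (hmem w hw))
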